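/- An instance of maximum submodular matching (MSM) consists of a finite simple graph $G=(V,E)$ with $V=[n]$ and a non-negative, monotone, submodular function $f:2^E\to\mathbb{R}_+$ with $f(\emptyset)=0$; an $f$-MSM of $G$ is a matching $M^*\subseteq E$ that maximizes $f(M^*)$. For a real number $C\ge 1$, a matching $M\subseteq E$ is a $C$-approximate $f$-MSM if $f(M)\ge C^{-1}f(M^*)$. A value-oracle algorithm is a deterministic procedure that receives $G$ as its input and can access $f$ only by calling an oracle, which on a query $S\subseteq E$ returns the real number $f(S)$ in unit time; it halts with an output $M\subseteq E$. It is a $C$-approximation algorithm if, on every instance, it halts and outputs a $C$-approximate $f$-MSM, and it runs in polynomial time if, for some polynomial $p$, it halts after at most $p(n)$ steps on every instance on $n$ vertices, where internal computation steps and oracle calls each count as one step. \textbf{Theorem.} For every real $C$ with $1\le C<\mathrm{e}/(\mathrm{e}-1)$, there is no polynomial-time $C$-approximation algorithm for $f$-MSM relative to a value oracle for $f$. The bound is unconditional and does not depend on how powerful the individual internal computation steps are. -/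

import Mathlib

namespace MSM

/-- `f` is a submodular function on the (finite) subsets of the ground set `X`. -/
def Submodular {X : Type*} [DecidableEq X] (f : Finset X → ℝ) : Prop :=
  ∀ A B : Finset X, f (A ∪ B) + f (A ∩ B) ≤ f A + f B

/-- The objective functions of the problem: non-negative, monotone, proper and submodular. -/
structure IsObjective {X : Type*} [DecidableEq X] (f : Finset X → ℝ) : Prop where
  nonneg : ∀ A, 0 ≤ f A
  monotone : ∀ A B : Finset X, A ⊆ B → f A ≤ f B
  proper : f ∅ = 0
  submodular : Submodular f

section Matching

variable {n : ℕ} {G : SimpleGraph (Fin n)}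

/-- A set `M ⊆ E(G)` of edges is a matching: no two distinct members share a vertex. -/
def IsMatching (M : Finset G.edgeSet) : Prop :=
  ∀ e ∈ M, ∀ e' ∈ M, e ≠ e' → ∀ v : Fin n, ¬ (v ∈ (e : Sym2 (Fin n)) ∧ v ∈ (e' : Sym2 (Fin n)))

/-- `M` is an `f`-MSM of `G`: a matching of maximum `f`-value. -/
def IsMSM (f : Finset G.edgeSet → ℝ) (M : Finset G.edgeSet) : Prop :=
  IsMatching M ∧ ∀ M' : Finset G.edgeSet, IsMatching M' → f M' ≤ f M

/-- `M` is an `α`-approximate `f`-MSM of `G`. -/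
def IsApproxMSM (α : ℝ) (f : Finset G.edgeSet → ℝ) (M : Finset G.edgeSet) : Prop :=
  IsMatching M ∧ ∀ Mopt : Finset G.edgeSet, IsMSM f Mopt → α⁻¹ * f Mopt ≤ f M

end Matching

/-- What a machine with configurations in `σ` does in one step on the input graph `G`:
an internal computation step, a call to the value oracle (the next configuration is a function of
the real number returned), or halting with an output. Only subsets of `E(G)` can be queried. -/
inductive Action {n : ℕ} (G : SimpleGraph (Fin n)) (σ : Type) : Type
  | compute (next : σ) : Action G σ
  | query (S : Finset G.edgeSet) (resume : ℝ → σ) : Action G σ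
  | halt (M : Finset G.edgeSet) : Action G σ

/-- A deterministic value-oracle machine for MSM. One machine serves all inputs; the graph `G` is
its read-only input, while the objective function can be accessed only through the oracle.
Internal steps are not restricted, so that oracle Turing machines, random access machines and real
random access machines are all instances, each of their elementary steps being one step here. -/
structure OracleMachine where
  State : Type
  start : {n : ℕ} → SimpleGraph (Fin n) → State
  step : {n : ℕ} → (G : SimpleGraph (Fin n)) → State → Action G State

namespace OracleMachine

variable (A : OracleMachine) {n : ℕ} (G : SimpleGraph (Fin n))

/-- The output of `A`, started in configuration `s` on input `G` with value oracle `f`, if it halts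
within `t` steps, and `none` otherwise. Every internal step, every oracle call and the final halting
step cost one unit of time. -/
def runFrom (f : Finset G.edgeSet → ℝ) : ℕ → A.State → Option (Finset G.edgeSet)
  | 0, _ => none
  | t + 1, s =>
    match A.step G s with
    | .compute s' => runFrom f t s'
    | .query S resume => runFrom f t (resume (f S))
    | .halt M => some M

/-- `A` halts on `(G, f)` within `t` steps, with output `M`. -/
def HaltsWithin (f : Finset G.edgeSet → ℝ) (t : ℕ) (M : Finset G.edgeSet) : Prop :=
  A.runFrom G f t (A.start G) = some M

/-- `A` runs in time polynomial in the number `n` of vertices, on all instances of MSM. -/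
def PolynomialTime : Prop :=
  ∃ p : Polynomial ℕ, ∀ (n : ℕ) (G : SimpleGraph (Fin n)) (f : Finset G.edgeSet → ℝ),
    IsObjective f → ∃ M : Finset G.edgeSet, A.HaltsWithin G f (p.eval n) M

/-- `A` is a `C`-approximation algorithm: on every instance it halts and outputs a
`C`-approximate `f`-MSM. -/
def IsApproximation (C : ℝ) : Prop :=
  ∀ (n : ℕ) (G : SimpleGraph (Fin n)) (f : Finset G.edgeSet → ℝ),
    IsObjective f → ∃ (t : ℕ) (M : Finset G.edgeSet), A.HaltsWithin G f t M ∧ IsApproxMSM C f M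

end OracleMachine

end MSM

namespace MSM

/-! In a complete bipartite graph with sides `Fin k` and `X`, let the value of an edge set depend
only on the vertices of `X` it covers. Matchings cover at most `k` of them, so the task becomes
submodular maximization under a cardinality bound, where `1 - 1/e` is the barrier. A `k`-set `O` is
hidden in `X = Fin k × Fin l`. The objective `hidden` agrees with the symmetric `1 - (1 - 1/k)^#S`,
capped at `1 - δ`, unless `S` meets `O` in more than `r` points and is not large
(`hidden_eq_of_card_inter_le`, `hidden_eq_of_large`). A union bound over graphs of functions
(`exists_graphOf_card_inter_le`) gives an `O` that neither the queries nor the output detect. The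
output is then worth at most `1 - (1 - 1/k)^k`, which tends to `1 - 1/e`, while `O` is worth at
least `min (1 - r/k) (1 - δ)`, which can be made close to `1`. -/

open Finset Filter Topology

namespace OracleMachine

variable (A : OracleMachine) {n : ℕ} (G : SimpleGraph (Fin n))

theorem runFrom_mono (f : Finset G.edgeSet → ℝ) {t t' : ℕ} (h : t ≤ t') {s : A.State}
    {M : Finset G.edgeSet} (hM : A.runFrom G f t s = some M) : A.runFrom G f t' s = some M := by
  induction t generalizing s t' with
  | zero => simp [runFrom] at hM
  | succ t ih =>
    obtain ⟨t', rfl⟩ : ∃ u, t' = u + 1 := ⟨t' - 1, by omega⟩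
    unfold runFrom at hM ⊢
    split at hM
    · exact ih (by omega) hM
    · exact ih (by omega) hM
    · exact hM

theorem HaltsWithin.unique {A : OracleMachine} {G : SimpleGraph (Fin n)}
    {f : Finset G.edgeSet → ℝ} {t t' : ℕ} {M M' : Finset G.edgeSet}
    (h : A.HaltsWithin G f t M) (h' : A.HaltsWithin G f t' M') : M = M' := by
  have h1 := A.runFrom_mono G f (le_max_left t t') h
  have h2 := A.runFrom_mono G f (le_max_right t t') h'
  exact Option.some.inj (h1.symm.trans h2)

/-- A run of length `t` is determined by the values of the oracle on at most `t` query sets. -/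
theorem exists_queries (f : Finset G.edgeSet → ℝ) (t : ℕ) (s : A.State) :
    ∃ Q : Finset (Finset G.edgeSet), #Q ≤ t ∧ ∀ f' : Finset G.edgeSet → ℝ,
      (∀ S ∈ Q, f' S = f S) → A.runFrom G f' t s = A.runFrom G f t s := by
  classical
  induction t generalizing s with
  | zero => exact ⟨∅, by simp, fun _ _ => rfl⟩
  | succ t ih =>
    rcases hs : A.step G s with s' | ⟨S, resume⟩ | M
    · obtain ⟨Q, hQ, h⟩ := ih s'
      refine ⟨Q, by omega, fun f' hf' => ?_⟩
      simp only [runFrom, hs]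
      exact h f' hf'
    · obtain ⟨Q, hQ, h⟩ := ih (resume (f S))
      refine ⟨insert S Q, (card_insert_le _ _).trans (by omega), fun f' hf' => ?_⟩
      simp only [runFrom, hs]
      rw [hf' S (mem_insert_self _ _)]
      exact h f' fun S' hS' => hf' S' (mem_insert_of_mem hS')
    · refine ⟨∅, by simp, fun f' _ => ?_⟩
      simp only [runFrom, hs]

end OracleMachine

/-! ### The convex profile along the hidden set -/

section Residual

/-- The convex sequence that starts at `1`, decreases like `(1 - 1 / k) ^ b` up to `b = r`, and is
affine from there on. -/
noncomputable def residual (k r b : ℕ) : ℝ :=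
  1 - ∑ j ∈ range b, (1 - 1 / (k : ℝ)) ^ min j r / k

variable {k : ℕ} (r : ℕ)

theorem ratio_nonneg (hk : 1 ≤ k) : (0 : ℝ) ≤ 1 - 1 / (k : ℝ) := by
  have : (1 : ℝ) ≤ k := by exact_mod_cast hk
  rw [sub_nonneg, div_le_one (by linarith)]
  exact this

theorem ratio_le_one (k : ℕ) : 1 - 1 / (k : ℝ) ≤ 1 := by
  have : (0 : ℝ) ≤ 1 / (k : ℝ) := by positivity
  linarith

theorem residual_zero (k : ℕ) : residual k r 0 = 1 := by simp [residual]

theorem residual_succ (k b : ℕ) :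
    residual k r (b + 1) = residual k r b - (1 - 1 / (k : ℝ)) ^ min b r / k := by
  simp only [residual, sum_range_succ]
  ring

theorem residual_add (k b x : ℕ) : residual k r (b + x) =
    residual k r b - ∑ j ∈ range x, (1 - 1 / (k : ℝ)) ^ min (b + j) r / k := by
  induction x with
  | zero => simp
  | succ x ih => rw [← add_assoc, residual_succ, ih, sum_range_succ]; ring

theorem residual_antitone (hk : 1 ≤ k) : Antitone (residual k r) := by
  refine antitone_nat_of_succ_le fun b => ?_
  rw [residual_succ]
  have := ratio_nonneg hk
  have : 0 ≤ (1 - 1 / (k : ℝ)) ^ min b r / k := by positivity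
  linarith

theorem residual_le_one (hk : 1 ≤ k) (b : ℕ) : residual k r b ≤ 1 :=
  (residual_antitone r hk (Nat.zero_le b)).trans_eq (residual_zero r k)

theorem residual_nonneg (hk : 1 ≤ k) {b : ℕ} (hb : b ≤ k) : 0 ≤ residual k r b := by
  have hk' : (0 : ℝ) < k := by exact_mod_cast hk
  have h : ∑ j ∈ range b, (1 - 1 / (k : ℝ)) ^ min j r / k ≤ ∑ j ∈ range b, 1 / (k : ℝ) :=
    sum_le_sum fun j _ => div_le_div_of_nonneg_right
      (pow_le_one₀ (ratio_nonneg hk) (ratio_le_one k)) hk'.le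
  have hb' : (b : ℝ) / k ≤ 1 := (div_le_one hk').2 (by exact_mod_cast hb)
  simp only [sum_const, card_range, nsmul_eq_mul, mul_one_div] at h
  unfold residual
  linarith

/-- The decrements `(1 - 1/k)^(min j r) / k` do not increase with `j`. -/
theorem residual_convex (hk : 1 ≤ k) (b x y : ℕ) :
    residual k r (b + x) + residual k r (b + y) ≤ residual k r b + residual k r (b + x + y) := by
  rw [residual_add r k b x, add_right_comm, residual_add r k (b + y) x]
  have h : ∑ j ∈ range x, (1 - 1 / (k : ℝ)) ^ min (b + y + j) r / k ≤
      ∑ j ∈ range x, (1 - 1 / (k : ℝ)) ^ min (b + j) r / k :=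
    sum_le_sum fun j _ => div_le_div_of_nonneg_right
      (pow_le_pow_of_le_one (ratio_nonneg hk) (ratio_le_one k)
        (min_le_min_right r (by omega))) (Nat.cast_nonneg k)
  linarith

theorem residual_eq_pow (k : ℕ) {b : ℕ} (hb : b ≤ r) :
    residual k r b = (1 - 1 / (k : ℝ)) ^ b := by
  induction b with
  | zero => simp [residual]
  | succ b ih =>
    rw [residual_succ, ih (by omega), min_eq_left (by omega), pow_succ]
    ring

/-- From `r` on the slope is `-(1 - 1/k)^r / k`, so the value at `k` is `(1 - 1/k)^r * (r / k)`. -/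
theorem residual_self_le (hk : 1 ≤ k) (hr : r ≤ k) : residual k r k ≤ r / k := by
  have hk' : (0 : ℝ) < k := by exact_mod_cast hk
  obtain ⟨x, hx⟩ := Nat.exists_eq_add_of_le hr
  have h : residual k r (r + x) = (1 - 1 / (k : ℝ)) ^ r * (r / k) := by
    rw [residual_add, residual_eq_pow r k le_rfl]
    simp only [min_eq_right (Nat.le_add_right r _), sum_const, card_range, nsmul_eq_mul]
    have : (x : ℝ) = k - r := by rw [hx]; push_cast; ring
    rw [this]
    field_simp
    ring
  rw [← hx] at h
  rw [h]
  exact mul_le_of_le_one_left (by positivity) (pow_le_one₀ (ratio_nonneg hk) (ratio_le_one k))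

end Residual

/-! ### The objective with a hidden set -/

section Hidden

variable {X : Type*} [DecidableEq X]

/-- The uncovered mass of a set `S` with respect to the hidden set `O`. -/
noncomputable def uncovered (k r : ℕ) (O S : Finset X) : ℝ :=
  residual k r #(S ∩ O) * (1 - 1 / (k : ℝ)) ^ #(S \ O)

/-- The objective function that hides the set `O`, truncated at the value `1 - δ`. -/
noncomputable def hidden (k r : ℕ) (δ : ℝ) (O S : Finset X) : ℝ :=
  min (1 - uncovered k r O S) (1 - δ)

variable {k : ℕ} (r : ℕ) {O : Finset X}

theorem uncovered_empty (O : Finset X) : uncovered k r O ∅ = 1 := by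
  simp [uncovered, residual_zero]

theorem uncovered_anti (hk : 1 ≤ k) (hO : #O ≤ k) {S T : Finset X} (h : S ⊆ T) :
    uncovered k r O T ≤ uncovered k r O S := by
  have h0 := ratio_nonneg hk
  unfold uncovered
  exact mul_le_mul (residual_antitone r hk (card_le_card (inter_subset_inter_right h)))
    (pow_le_pow_of_le_one h0 (ratio_le_one k) (card_le_card (sdiff_subset_sdiff h subset_rfl)))
    (pow_nonneg h0 _)
    (residual_nonneg r hk ((card_le_card inter_subset_right).trans hO))

theorem uncovered_supermodular (hk : 1 ≤ k) (hO : #O ≤ k) (A B : Finset X) :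
    uncovered k r O A + uncovered k r O B ≤
      uncovered k r O (A ∪ B) + uncovered k r O (A ∩ B) := by
  obtain ⟨x, hx⟩ := Nat.exists_eq_add_of_le
    (card_le_card (inter_subset_inter_right inter_subset_left : (A ∩ B) ∩ O ⊆ A ∩ O))
  obtain ⟨y, hy⟩ := Nat.exists_eq_add_of_le
    (card_le_card (inter_subset_inter_right inter_subset_right : (A ∩ B) ∩ O ⊆ B ∩ O))
  obtain ⟨u, hu⟩ := Nat.exists_eq_add_of_le
    (card_le_card (sdiff_subset_sdiff inter_subset_left subset_rfl : (A ∩ B) \ O ⊆ A \ O))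
  obtain ⟨v, hv⟩ := Nat.exists_eq_add_of_le
    (card_le_card (sdiff_subset_sdiff inter_subset_right subset_rfl : (A ∩ B) \ O ⊆ B \ O))
  have hxy : #((A ∪ B) ∩ O) = #((A ∩ B) ∩ O) + x + y := by
    have h := card_union_add_card_inter (A ∩ O) (B ∩ O)
    rw [← union_inter_distrib_right, ← inter_inter_distrib_right] at h
    omega
  have huv : #((A ∪ B) \ O) = #((A ∩ B) \ O) + u + v := by
    have h := card_union_add_card_inter (A \ O) (B \ O)
    rw [← union_sdiff_distrib, show (A \ O) ∩ (B \ O) = (A ∩ B) \ O by grind] at h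
    omega
  have hle : #((A ∪ B) ∩ O) ≤ k := (card_le_card inter_subset_right).trans hO
  unfold uncovered
  rw [hx, hy, hu, hv, hxy, huv]
  rw [hxy] at hle
  generalize #((A ∩ B) ∩ O) = b at *
  generalize #((A ∩ B) \ O) = a
  have q0 := ratio_nonneg hk
  have q1 := ratio_le_one k
  have hu0 := pow_nonneg q0 u
  have hv0 := pow_nonneg q0 v
  have hu1 : 0 ≤ 1 - (1 - 1 / (k : ℝ)) ^ u := sub_nonneg.2 (pow_le_one₀ q0 q1)
  have hv1 : 0 ≤ 1 - (1 - 1 / (k : ℝ)) ^ v := sub_nonneg.2 (pow_le_one₀ q0 q1)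
  have ha0 := pow_nonneg q0 a
  simp only [pow_add]
  generalize (1 - 1 / (k : ℝ)) ^ u = U at *
  generalize (1 - 1 / (k : ℝ)) ^ v = V at *
  generalize (1 - 1 / (k : ℝ)) ^ a = W at *
  have h0 : 0 ≤ residual k r b := residual_nonneg r hk (by omega)
  have h1 := sub_nonneg.2 (residual_antitone r hk (Nat.le_add_right b x))
  have h2 := sub_nonneg.2 (residual_antitone r hk (Nat.le_add_right b y))
  have h3 := sub_nonneg.2 (residual_convex r hk b x y)
  generalize residual k r (b + x + y) = p3 at *
  generalize residual k r (b + x) = p1 at *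
  generalize residual k r (b + y) = p2 at *
  generalize residual k r b = p0 at *
  -- The supermodularity gap `W * (p0 + p3 * U * V - p1 * U - p2 * V)`, written as a sum of
  -- nonnegative terms; convexity of `residual` enters in the last one.
  have key : 0 ≤ W * (p0 * ((1 - U) * (1 - V)) + (p0 - p1) * (U * (1 - V))
      + (p0 - p2) * ((1 - U) * V) + (p0 + p3 - (p1 + p2)) * (U * V)) := by positivity
  linarith [key]

theorem hidden_isObjective {δ : ℝ} (hδ : δ ≤ 1) (hk : 1 ≤ k) (hO : #O ≤ k) :
    IsObjective (hidden k r δ O) := by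
  have mono : ∀ A B : Finset X, A ⊆ B → hidden k r δ O A ≤ hidden k r δ O B :=
    fun A B h => min_le_min_right _ (sub_le_sub_left (uncovered_anti r hk hO h) 1)
  have h0 : hidden k r δ O ∅ = 0 := by simp [hidden, uncovered_empty, hδ]
  refine ⟨fun A => h0.symm.trans_le (mono ∅ A (empty_subset A)), mono, h0, fun A B => ?_⟩
  have h := uncovered_supermodular r hk hO A B
  have hA := uncovered_anti r hk hO (inter_subset_left : A ∩ B ⊆ A)
  have hB := uncovered_anti r hk hO (inter_subset_right : A ∩ B ⊆ B)
  have hA' := uncovered_anti r hk hO (subset_union_left : A ⊆ A ∪ B)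
  have hB' := uncovered_anti r hk hO (subset_union_right : B ⊆ A ∪ B)
  unfold hidden
  -- If `A` or `B` reaches the cap, so does `A ∪ B`, and monotonicity from `A ∩ B` to the other set
  -- suffices; otherwise supermodularity of `uncovered` applies.
  grind

theorem hidden_empty (k : ℕ) (δ : ℝ) (S : Finset X) :
    hidden k r δ ∅ S = min (1 - (1 - 1 / (k : ℝ)) ^ #S) (1 - δ) := by
  simp [hidden, uncovered, residual_zero]

theorem hidden_eq_of_card_inter_le (k : ℕ) (δ : ℝ) {S : Finset X} (h : #(S ∩ O) ≤ r) :
    hidden k r δ O S = hidden k r δ ∅ S := by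
  rw [hidden_empty, hidden, uncovered, residual_eq_pow r k h, ← pow_add,
    card_inter_add_card_sdiff]

theorem hidden_eq_of_large {δ : ℝ} {L : ℕ} (hk : 1 ≤ k) (hO : #O ≤ k)
    (hL : (1 - 1 / (k : ℝ)) ^ L ≤ δ) {S : Finset X} (h : k + L ≤ #S) :
    hidden k r δ O S = 1 - δ := by
  refine min_eq_right (sub_le_sub_left (le_trans ?_ hL) 1)
  have h1 : L ≤ #(S \ O) := by
    have := card_inter_add_card_sdiff S O
    have := (card_le_card (inter_subset_right : S ∩ O ⊆ O)).trans hO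
    omega
  have q0 := ratio_nonneg hk
  exact (mul_le_of_le_one_left (pow_nonneg q0 _) (residual_le_one r hk _)).trans
    (pow_le_pow_of_le_one q0 (ratio_le_one k) h1)

theorem le_hidden_self {δ : ℝ} (hk : 1 ≤ k) (hr : r ≤ k) (hO : #O = k) :
    min (1 - (r : ℝ) / k) (1 - δ) ≤ hidden k r δ O O := by
  refine min_le_min_right _ (sub_le_sub_left ?_ 1)
  simpa [uncovered, hO] using residual_self_le r hk hr

end Hidden

/-! ### Union bound over graphs of functions -/

section Counting

variable {k l : ℕ}

/-- The graph of a function, as a set of pairs. -/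
def graphOf (h : Fin k → Fin l) : Finset (Fin k × Fin l) := univ.image fun i => (i, h i)

theorem mem_graphOf {h : Fin k → Fin l} {x : Fin k × Fin l} : x ∈ graphOf h ↔ h x.1 = x.2 := by
  rcases x with ⟨i, y⟩
  simp [graphOf]

theorem card_graphOf (h : Fin k → Fin l) : #(graphOf h) = k := by
  rw [graphOf, card_image_of_injective _ fun i j hij => congrArg Prod.fst hij]
  simp

/-- A graph containing `R` has its values prescribed at `#R` distinct arguments, and the others are
free. -/
theorem card_filter_subset_graphOf (R : Finset (Fin k × Fin l)) :
    #{h : Fin k → Fin l | R ⊆ graphOf h} * l ^ #R ≤ l ^ k := by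
  rcases ({h : Fin k → Fin l | R ⊆ graphOf h} : Finset _).eq_empty_or_nonempty with he | ⟨g, hg⟩
  · simp [he]
  · have hg' : R ⊆ graphOf g := (mem_filter.1 hg).2
    have hinj : Set.InjOn Prod.fst (R : Set (Fin k × Fin l)) := fun x hx y hy hxy =>
      Prod.ext hxy (by rw [← mem_graphOf.1 (hg' hx), ← mem_graphOf.1 (hg' hy), hxy])
    have hcard : #(R.image Prod.fst) = #R := card_image_of_injOn hinj
    have hsub : ({h : Fin k → Fin l | R ⊆ graphOf h} : Finset _) ⊆
        Fintype.piFinset fun i => if i ∈ R.image Prod.fst then {g i} else univ := by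
      intro h hh
      rw [Fintype.mem_piFinset]
      intro i
      split_ifs with hi
      · obtain ⟨x, hx, rfl⟩ := mem_image.1 hi
        rw [mem_singleton, mem_graphOf.1 (hg' hx), mem_graphOf.1 ((mem_filter.1 hh).2 hx)]
      · exact mem_univ _
    calc #{h : Fin k → Fin l | R ⊆ graphOf h} * l ^ #R
        ≤ l ^ #(R.image Prod.fst)ᶜ * l ^ #R := by
          gcongr
          refine (card_le_card hsub).trans_eq ?_
          rw [Fintype.card_piFinset, ← prod_const, ← Finset.prod_subset (subset_univ _)]
          · refine prod_congr rfl fun i hi => ?_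
            rw [if_neg (mem_compl.1 hi), card_univ, Fintype.card_fin]
          · intro i _ hi
            rw [if_pos (by simpa using hi), card_singleton]
      _ = l ^ k := by
          rw [← pow_add, ← hcard, card_compl_add_card, Fintype.card_fin]

theorem card_filter_lt_card_inter_graphOf (r : ℕ) (S : Finset (Fin k × Fin l)) :
    #{h : Fin k → Fin l | r < #(S ∩ graphOf h)} * l ^ (r + 1) ≤ #S ^ (r + 1) * l ^ k := by
  have hsub : ({h : Fin k → Fin l | r < #(S ∩ graphOf h)} : Finset _) ⊆
      (powersetCard (r + 1) S).biUnion fun R => {h : Fin k → Fin l | R ⊆ graphOf h} := by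
    intro h hh
    obtain ⟨R, hR, hc⟩ := exists_subset_card_eq (Nat.succ_le_of_lt (mem_filter.1 hh).2)
    exact mem_biUnion.2 ⟨R, mem_powersetCard.2 ⟨hR.trans inter_subset_left, hc⟩,
      mem_filter.2 ⟨mem_univ _, hR.trans inter_subset_right⟩⟩
  calc #{h : Fin k → Fin l | r < #(S ∩ graphOf h)} * l ^ (r + 1)
      ≤ (∑ R ∈ powersetCard (r + 1) S, #{h : Fin k → Fin l | R ⊆ graphOf h}) * l ^ (r + 1) := by
        gcongr
        exact (card_le_card hsub).trans card_biUnion_le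
    _ = ∑ R ∈ powersetCard (r + 1) S, #{h : Fin k → Fin l | R ⊆ graphOf h} * l ^ #R := by
        rw [sum_mul]
        exact sum_congr rfl fun R hR => by rw [(mem_powersetCard.1 hR).2]
    _ ≤ ∑ R ∈ powersetCard (r + 1) S, l ^ k :=
        sum_le_sum fun R _ => card_filter_subset_graphOf R
    _ ≤ #S ^ (r + 1) * l ^ k := by
        rw [sum_const, card_powersetCard, smul_eq_mul]
        gcongr
        exact Nat.choose_le_pow _ _

/-- Few small sets leave room for a graph that meets none of them in more than `r` points. -/
theorem exists_graphOf_card_inter_le (hl : 0 < l) {r s : ℕ} (Q : Finset (Finset (Fin k × Fin l)))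
    (hs : ∀ S ∈ Q, #S ≤ s) (hQ : #Q * s ^ (r + 1) < l ^ (r + 1)) :
    ∃ h : Fin k → Fin l, ∀ S ∈ Q, #(S ∩ graphOf h) ≤ r := by
  by_contra! hcon
  have hsub : (univ : Finset (Fin k → Fin l)) ⊆
      Q.biUnion fun S => {h : Fin k → Fin l | r < #(S ∩ graphOf h)} := fun h _ => by
    obtain ⟨S, hS, hr⟩ := hcon h
    exact mem_biUnion.2 ⟨S, hS, mem_filter.2 ⟨mem_univ _, hr⟩⟩
  have h1 : l ^ k * l ^ (r + 1) ≤ #Q * s ^ (r + 1) * l ^ k :=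
    calc l ^ k * l ^ (r + 1)
        = #(univ : Finset (Fin k → Fin l)) * l ^ (r + 1) := by simp
      _ ≤ (∑ S ∈ Q, #{h : Fin k → Fin l | r < #(S ∩ graphOf h)}) * l ^ (r + 1) := by
          gcongr
          exact (card_le_card hsub).trans card_biUnion_le
      _ ≤ ∑ S ∈ Q, s ^ (r + 1) * l ^ k := by
          rw [sum_mul]
          refine sum_le_sum fun S hS => (card_filter_lt_card_inter_graphOf r S).trans ?_
          gcongr
          exact hs S hS
      _ = #Q * s ^ (r + 1) * l ^ k := by rw [sum_const, smul_eq_mul, mul_assoc]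
  rw [mul_comm] at h1
  exact absurd (Nat.le_of_mul_le_mul_right h1 (pow_pos hl k)) (not_le.2 hQ)

end Counting

/-! ### Matchings and covered vertices -/

section Bipartite

variable {k n : ℕ} {X : Type*} (e : Fin k ⊕ X ≃ Fin n)

/-- The complete bipartite graph between `Fin k` and `X`, with its vertices numbered by `e`. -/
def bipartite : SimpleGraph (Fin n) := (completeBipartiteGraph (Fin k) X).comap e.symm

theorem exists_eq_of_mem_edgeSet {a : Sym2 (Fin n)} (ha : a ∈ (bipartite e).edgeSet) :
    ∃ i x, a = s(e (Sum.inl i), e (Sum.inr x)) := by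
  induction a using Sym2.ind with
  | _ u v =>
    obtain ⟨u, rfl⟩ := e.surjective u
    obtain ⟨v, rfl⟩ := e.surjective v
    rcases u with i | x <;> rcases v with j | y <;> simp [bipartite] at ha ⊢

theorem mem_edgeSet_bipartite (i : Fin k) (x : X) :
    s(e (Sum.inl i), e (Sum.inr x)) ∈ (bipartite e).edgeSet := by
  simp [bipartite]

variable [Fintype X]

open Classical in
/-- The vertices in `X` that are covered by a set of edges. -/
noncomputable def covered (S : Finset (bipartite e).edgeSet) : Finset X :=
  {x | ∃ a ∈ S, e (Sum.inr x) ∈ (a : Sym2 (Fin n))}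

theorem mem_covered {S : Finset (bipartite e).edgeSet} {x : X} :
    x ∈ covered e S ↔ ∃ a ∈ S, e (Sum.inr x) ∈ (a : Sym2 (Fin n)) := by
  simp [covered]

theorem covered_mono {S T : Finset (bipartite e).edgeSet} (h : S ⊆ T) :
    covered e S ⊆ covered e T := fun x hx => by
  obtain ⟨a, ha, hxa⟩ := (mem_covered e).1 hx
  exact (mem_covered e).2 ⟨a, h ha, hxa⟩

/-- Covering respects intersections only up to inclusion; monotonicity of `g` absorbs the loss. -/
theorem isObjective_comp_covered [DecidableEq X] {g : Finset X → ℝ} (hg : IsObjective g) :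
    IsObjective fun S => g (covered e S) where
  nonneg S := hg.nonneg _
  monotone A B h := hg.monotone _ _ (covered_mono e h)
  proper := by
    have : covered e ∅ = ∅ := by simp [covered]
    simp only [this, hg.proper]
  submodular A B := by
    have h1 : covered e (A ∪ B) ⊆ covered e A ∪ covered e B := fun x hx => by
      obtain ⟨a, ha, hxa⟩ := (mem_covered e).1 hx
      rcases mem_union.1 ha with ha | ha
      · exact mem_union_left _ ((mem_covered e).2 ⟨a, ha, hxa⟩)
      · exact mem_union_right _ ((mem_covered e).2 ⟨a, ha, hxa⟩)
    have h2 : covered e (A ∩ B) ⊆ covered e A ∩ covered e B :=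
      subset_inter (covered_mono e inter_subset_left) (covered_mono e inter_subset_right)
    exact (add_le_add (hg.monotone _ _ h1) (hg.monotone _ _ h2)).trans (hg.submodular _ _)

theorem card_covered_le {M : Finset (bipartite e).edgeSet} (hM : IsMatching M) :
    #(covered e M) ≤ k := by
  have h : ∀ x : covered e M, ∃ i : Fin k, ∃ a ∈ M,
      (a : Sym2 (Fin n)) = s(e (Sum.inl i), e (Sum.inr x.1)) := fun ⟨x, hx⟩ => by
    obtain ⟨a, ha, hxa⟩ := (mem_covered e).1 hx
    obtain ⟨i, y, hy⟩ := exists_eq_of_mem_edgeSet e a.2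
    rw [hy] at hxa
    have : x = y := by simpa using hxa
    exact ⟨i, a, ha, this ▸ hy⟩
  choose i a ha hia using h
  have hinj : Function.Injective i := fun x y hxy => by
    have hab : a x = a y := by
      by_contra hne
      refine hM _ (ha x) _ (ha y) hne (e (Sum.inl (i x))) ⟨?_, ?_⟩
      · rw [hia x]; exact Sym2.mem_mk_left _ _
      · rw [hia y, hxy]; exact Sym2.mem_mk_left _ _
    have h := hia x
    rw [hab, hia y, hxy] at h
    exact Subtype.ext (by simpa [eq_comm] using h)
  simpa using Fintype.card_le_of_injective i hinj

theorem exists_matching_covered_eq [DecidableEq X] {F : Fin k → X} (hF : Function.Injective F) :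
    ∃ M : Finset (bipartite e).edgeSet, IsMatching M ∧ covered e M = univ.image F := by
  classical
  refine ⟨univ.image fun i => ⟨_, mem_edgeSet_bipartite e i (F i)⟩, ?_, ?_⟩
  · intro a ha b hb hab v hv
    obtain ⟨i, -, rfl⟩ := mem_image.1 ha
    obtain ⟨j, -, rfl⟩ := mem_image.1 hb
    obtain ⟨v, rfl⟩ := e.surjective v
    have hij : i ≠ j := fun h => hab (by rw [h])
    rcases v with v | v
    · simp at hv
      exact hij (hv.1.symm.trans hv.2)
    · simp at hv
      exact hij (hF (hv.1.symm.trans hv.2))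
  · ext x
    rw [mem_covered, mem_image]
    constructor
    · rintro ⟨a, ha, hx⟩
      obtain ⟨i, -, rfl⟩ := mem_image.1 ha
      exact ⟨i, mem_univ i, by simpa [eq_comm] using hx⟩
    · rintro ⟨i, -, rfl⟩
      exact ⟨_, mem_image_of_mem _ (mem_univ i), Sym2.mem_mk_right _ _⟩

end Bipartite

/-- Without an optimum the approximation guarantee would be vacuous. -/
theorem exists_isMSM {n : ℕ} {G : SimpleGraph (Fin n)} (f : Finset G.edgeSet → ℝ) :
    ∃ M, IsMSM f M := by
  obtain ⟨M, hM, hmax⟩ := Set.exists_max_image {M : Finset G.edgeSet | IsMatching M} f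
    (Set.toFinite _) ⟨∅, fun a ha => by simp at ha⟩
  exact ⟨M, hM, hmax⟩

/-! ### Limits and the choice of parameters -/

section Asymptotics

theorem ratio_pow_le_exp {k : ℕ} (hk : 1 ≤ k) (c : ℕ) :
    (1 - 1 / (k : ℝ)) ^ (k * c) ≤ Real.exp (-c) := by
  have hk' : (k : ℝ) ≠ 0 := by positivity
  calc (1 - 1 / (k : ℝ)) ^ (k * c) ≤ Real.exp (-(1 / (k : ℝ))) ^ (k * c) :=
        pow_le_pow_left₀ (ratio_nonneg hk) (Real.one_sub_le_exp_neg _) _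
    _ = Real.exp (-c) := by
        rw [← Real.exp_nat_mul]
        congr 1
        push_cast
        field_simp

theorem tendsto_ratio_pow :
    Tendsto (fun k : ℕ => (1 - 1 / (k : ℝ)) ^ k) atTop (𝓝 (Real.exp (-1))) := by
  have h := Real.tendsto_one_add_div_pow_exp (-1)
  refine h.congr fun k => ?_
  rw [neg_div, ← sub_eq_add_neg]

theorem eventually_eval_mul_lt_pow (p : Polynomial ℕ) (c : ℕ) :
    ∃ r : ℕ, ∀ᶠ k : ℕ in atTop,
      (p.eval (k + k * k ^ 2) + 1) * (k + k * c) ^ (r + 1) < (k ^ 2) ^ (r + 1) := by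
  set P : Polynomial ℕ := p.comp (Polynomial.X + Polynomial.X * Polynomial.X ^ 2) + 1 with hP
  -- After cancelling `k^(r + 1)`, a polynomial of degree at most `r` in `k` has to stay below `k^(r
  -- + 1)`.
  refine ⟨P.natDegree, ?_⟩
  set r := P.natDegree
  set N : Polynomial ℝ := P.map (Nat.castRingHom ℝ) * Polynomial.C ((1 + c : ℝ) ^ (r + 1)) with hN
  have hdeg : N.degree < (Polynomial.X ^ (r + 1) : Polynomial ℝ).degree := by
    rw [Polynomial.degree_X_pow]
    refine (Polynomial.degree_mul_le _ _).trans_lt ?_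
    refine (add_le_add (Polynomial.degree_map_le.trans Polynomial.degree_le_natDegree)
      Polynomial.degree_C_le).trans_lt ?_
    rw [add_zero]
    exact_mod_cast Nat.lt_succ_self r
  have h := (Polynomial.div_tendsto_atTop_zero_of_degree_lt N (Polynomial.X ^ (r + 1)) hdeg).comp
    tendsto_natCast_atTop_atTop
  filter_upwards [h.eventually_lt_const one_pos, eventually_ge_atTop 1] with k hk hk1
  have hk' : (0 : ℝ) < k := by exact_mod_cast hk1
  simp only [Function.comp_apply, Polynomial.eval_pow, Polynomial.eval_X] at hk
  rw [div_lt_one (by positivity)] at hk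
  have hev : N.eval (k : ℝ) = ((p.eval (k + k * k ^ 2) + 1 : ℕ) : ℝ) * (1 + c) ^ (r + 1) := by
    rw [hN, Polynomial.eval_mul, Polynomial.eval_C, Polynomial.eval_natCast_map, hP]
    simp [Polynomial.eval_comp]
  rw [hev] at hk
  have hk2 : (p.eval (k + k * k ^ 2) + 1) * (1 + c) ^ (r + 1) < k ^ (r + 1) := by
    exact_mod_cast hk
  calc (p.eval (k + k * k ^ 2) + 1) * (k + k * c) ^ (r + 1)
      = ((p.eval (k + k * k ^ 2) + 1) * (1 + c) ^ (r + 1)) * k ^ (r + 1) := by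
        rw [show k + k * c = (1 + c) * k by ring, mul_pow]; ring
    _ < k ^ (r + 1) * k ^ (r + 1) := by gcongr
    _ = (k ^ 2) ^ (r + 1) := by rw [← pow_mul, ← pow_add]; ring_nf

end Asymptotics

/-- A machine that stops on the graph `bipartite e` before it has made enough queries misses some
hidden set, and is then far from the optimum. -/
theorem hidden_le_of_halts {A : OracleMachine} {C : ℝ} (hA : A.IsApproximation C) (hC : 0 < C)
    {k l r L t n : ℕ} {δ : ℝ} (e : Fin k ⊕ (Fin k × Fin l) ≃ Fin n) (hk : 1 ≤ k)
    (hr : r ≤ k) (hl : 0 < l) (hδ : δ ≤ 1) (hL : (1 - 1 / (k : ℝ)) ^ L ≤ δ)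
    (ht : (t + 1) * (k + L) ^ (r + 1) < l ^ (r + 1))
    (hhalt : ∀ f : Finset (bipartite e).edgeSet → ℝ, IsObjective f →
      ∃ M, A.HaltsWithin (bipartite e) f t M) :
    min (1 - (r : ℝ) / k) (1 - δ) ≤ C * (1 - (1 - 1 / (k : ℝ)) ^ k) := by
  classical
  let F (O : Finset (Fin k × Fin l)) (S : Finset (bipartite e).edgeSet) : ℝ :=
    hidden k r δ O (covered e S)
  have hF (O) (hO : #O ≤ k) : IsObjective (F O) :=
    isObjective_comp_covered e (hidden_isObjective r hδ hk hO)
  obtain ⟨M, hM⟩ := hhalt (F ∅) (hF ∅ (by simp))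
  obtain ⟨Q, hQ, hdet⟩ := A.exists_queries (bipartite e) (F ∅) t (A.start (bipartite e))
  have hmatch : IsMatching M := by
    obtain ⟨t', M', hM', happ⟩ := hA n (bipartite e) (F ∅) (hF ∅ (by simp))
    rw [hM.unique hM']
    exact happ.1
  have hcov := card_covered_le e hmatch
  -- The output `M` is treated as one more query, hence `t + 1`, so that its value is also
  -- unaffected by the hidden set.
  have hcard : #({S ∈ (insert M Q).image (covered e) | #S ≤ k + L}) ≤ t + 1 :=
    (card_filter_le _ _).trans (card_image_le.trans ((card_insert_le _ _).trans (by omega)))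
  obtain ⟨h, hh⟩ := exists_graphOf_card_inter_le hl (r := r) (s := k + L)
    {S ∈ (insert M Q).image (covered e) | #S ≤ k + L} (fun S hS => (mem_filter.1 hS).2)
    ((Nat.mul_le_mul_right _ hcard).trans_lt ht)
  have hagree : ∀ S ∈ insert M Q, F (graphOf h) S = F ∅ S := fun S hS => by
    rcases le_total #(covered e S) (k + L) with hle | hge
    · exact hidden_eq_of_card_inter_le r k δ
        (hh _ (mem_filter.2 ⟨mem_image_of_mem _ hS, hle⟩))
    · exact (hidden_eq_of_large r hk (card_graphOf h).le hL hge).trans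
        (hidden_eq_of_large r hk (by simp) hL hge).symm
  have hrun : A.HaltsWithin (bipartite e) (F (graphOf h)) t M :=
    (hdet _ fun S hS => hagree S (mem_insert_of_mem hS)).trans hM
  obtain ⟨t', M', hM', -, happ⟩ := hA n (bipartite e) (F (graphOf h)) (hF _ (card_graphOf h).le)
  obtain rfl := hrun.unique hM'
  obtain ⟨Mopt, hopt⟩ := exists_isMSM (F (graphOf h))
  obtain ⟨N, hN, hNcov⟩ := exists_matching_covered_eq e
    (F := fun i => (i, h i)) fun i j hij => congrArg Prod.fst hij
  have h1 : min (1 - (r : ℝ) / k) (1 - δ) ≤ F (graphOf h) N := by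
    have : covered e N = graphOf h := hNcov
    simp only [F, this]
    exact le_hidden_self r hk hr (card_graphOf h)
  have h2 : F (graphOf h) M ≤ 1 - (1 - 1 / (k : ℝ)) ^ k := by
    rw [hagree M (mem_insert_self _ _)]
    simp only [F, hidden_empty]
    exact (min_le_left _ _).trans (sub_le_sub_left
      (pow_le_pow_of_le_one (ratio_nonneg hk) (ratio_le_one k) hcov) 1)
  have h3 := (inv_mul_le_iff₀ hC).1 (happ Mopt hopt)
  calc min (1 - (r : ℝ) / k) (1 - δ) ≤ F (graphOf h) Mopt := h1.trans (hopt.2 N hN)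
    _ ≤ C * F (graphOf h) M := h3
    _ ≤ C * (1 - (1 - 1 / (k : ℝ)) ^ k) := by gcongr

end MSM

open Filter Topology in
theorem mainTheorem6 (C : ℝ) (hC : 1 ≤ C) (hCe : C < Real.exp 1 / (Real.exp 1 - 1)) :
    ¬ ∃ A : MSM.OracleMachine, A.PolynomialTime ∧ A.IsApproximation C := by
  rintro ⟨A, ⟨p, hp⟩, hA⟩
  have hC0 : 0 < C := by linarith
  have he : 1 < Real.exp 1 := Real.one_lt_exp_iff.2 one_pos
  have hlim : C * (1 - Real.exp (-1)) < 1 := by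
    rw [lt_div_iff₀ (by linarith)] at hCe
    rw [Real.exp_neg]
    field_simp
    linarith
  -- `a` separates `C` times the limiting value of the output from the optimum; the cap is `1 - δ =
  -- a`, and `c` makes `L = k * c` elements outside `O` enough to reach it.
  obtain ⟨a, ha, ha1⟩ := exists_between hlim
  obtain ⟨c, hc⟩ : ∃ c : ℕ, Real.exp (-c) < 1 - a := by
    have h := Real.tendsto_exp_neg_atTop_nhds_zero.comp (tendsto_natCast_atTop_atTop (R := ℝ))
    exact (h.eventually_lt_const (sub_pos.2 ha1)).exists
  have ha0 : 0 < a := by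
    refine lt_of_le_of_lt (mul_nonneg hC0.le (sub_nonneg.2 ?_)) ha
    exact Real.exp_le_one_iff.2 (by norm_num)
  obtain ⟨r, hr⟩ := MSM.eventually_eval_mul_lt_pow p c
  have hk1 : ∀ᶠ k : ℕ in atTop, C * (1 - (1 - 1 / (k : ℝ)) ^ k) < a :=
    ((tendsto_const_nhds.sub MSM.tendsto_ratio_pow).const_mul C).eventually_lt_const ha
  have hk2 : ∀ᶠ k : ℕ in atTop, (r : ℝ) / k < 1 - a :=
    (tendsto_const_div_atTop_nhds_zero_nat (r : ℝ)).eventually_lt_const (sub_pos.2 ha1)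
  obtain ⟨k, hr, hk1, hk2, hk3, hk4⟩ := (hr.and (hk1.and (hk2.and
    ((eventually_ge_atTop 1).and (eventually_ge_atTop r))))).exists
  -- With `l = k ^ 2` the ratio `(k + L) / l` is `(1 + c) / k`, so its power `r + 1` beats the
  -- polynomial running time.
  have e : Fin k ⊕ (Fin k × Fin (k ^ 2)) ≃ Fin (k + k * k ^ 2) :=
    Fintype.equivFinOfCardEq (by simp)
  have h := MSM.hidden_le_of_halts hA hC0 (δ := 1 - a) (L := k * c) e hk3 hk4
    (pow_pos (by omega) 2) (by linarith)
    ((MSM.ratio_pow_le_exp hk3 c).trans hc.le) hr (hp _ _)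
  have : a ≤ min (1 - (r : ℝ) / k) (1 - (1 - a)) := le_min (by linarith) (by linarith)
  linarith
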